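/- Let $\mathfrak H$ be a complex Hilbert space with inner product $(\cdot,\cdot)$, and let $a$, $b$ be positive symmetric operators in $\mathfrak H$ (linear operators on not necessarily dense subspaces, with $(ax,y)=(x,ay)$ and $(ax,x)\ge 0$ for $x,y\in\mathrm{dom}\,a$, and likewise for $b$). Let $$D_*(a)=\{y\in\mathfrak H:\ \exists m_y\ \ |(ax,y)|^2\le m_y\,(ax,x)\ \text{ for all } x\in\mathrm{dom}\,a\}$$ be the form domain of $a$, and suppose that $D_*(a)\cap D_*(b)$ is dense in $\mathfrak H$. Let $\mathfrak H_a$ be the completion of $\mathrm{ran}\,a$ with respect to the inner product $\langle ax,ay\rangle=(ax,y)$, define $\mathfrak H_b$ in the same way, and let $J:\mathfrak H_a\oplus\mathfrak H_b\to\mathfrak H$ be the densely defined operator with $$\mathrm{dom}\,J=\mathrm{ran}\,a\oplus\mathrm{ran}\,b,\qquad J(ax\oplus by)=ax+by .$$ For positive selfadjoint operators $A,B$ in $\mathfrak H$ write $A\le B$ if $\mathrm{dom}\,B^{1/2}\subseteq\mathrm{dom}\,A^{1/2}$ and $\|A^{1/2}x\|\le\|B^{1/2}x\|$ for all $x\in\mathrm{dom}\,B^{1/2}$.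 If $\mathrm{dom}\,A^{1/2}\cap\mathrm{dom}\,B^{1/2}$ is dense, the form sum $A\stackrel{.}{+}B$ is the operator associated with the closed form $(A^{1/2}x,A^{1/2}y)+(B^{1/2}x,B^{1/2}y)$ on $D=\mathrm{dom}\,A^{1/2}\cap\mathrm{dom}\,B^{1/2}$; that is, $x\in\mathrm{dom}(A\stackrel{.}{+}B)$ and $(A\stackrel{.}{+}B)x=z$ if and only if $x\in D$ and $(A^{1/2}x,A^{1/2}y)+(B^{1/2}x,B^{1/2}y)=(z,y)$ for all $y\in D$. Then $a$ and $b$ each have a unique smallest positive selfadjoint extension (the Krein–von Neumann extension) $a_{\mathsf K}$, respectively $b_{\mathsf K}$, and $$a_{\mathsf K}\stackrel{.}{+}b_{\mathsf K}=J^{**}J^{*}.$$ -/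

import Mathlib

namespace FormSum

noncomputable section

variable {H : Type*} [NormedAddCommGroup H] [InnerProductSpace ℂ H]

/-- `a` is a positive, symmetric operator: `(ax, y) = (x, ay)` and `(ax, x) ≥ 0` on `dom a`.
The domain is not assumed to be dense. -/
structure IsPositiveSymmetric (a : H →ₗ.[ℂ] H) : Prop where
  symm : ∀ x y : a.domain, inner ℂ (a x) (y : H) = inner ℂ (x : H) (a y)
  nonneg : ∀ x : a.domain, 0 ≤ (inner ℂ (a x) (x : H)).re

/-- The form domain of `a`: all `y` for which there is a constant `m` such that
`|(ax, y)|² ≤ m (ax, x)` for all `x ∈ dom a`. -/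
def formDomain (a : H →ₗ.[ℂ] H) : Set H :=
  {y | ∃ m : ℝ, ∀ x : a.domain, ‖inner ℂ (a x) y‖ ^ 2 ≤ m * (inner ℂ (a x) (x : H)).re}

section EnergySpace

variable {a b : H →ₗ.[ℂ] H}

/-- The range of `a`, as a type of its own which is going to carry the inner product
`⟨ax, ay⟩ = (ax, y)` instead of the one inherited from `H`. -/
def RanSpace (_ha : IsPositiveSymmetric a) (_hd : Dense (formDomain a)) : Type _ :=
  LinearMap.range a.toFun

variable (ha : IsPositiveSymmetric a) (hd : Dense (formDomain a))

instance : AddCommGroup (RanSpace ha hd) :=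
  inferInstanceAs (AddCommGroup (LinearMap.range a.toFun))

instance : Module ℂ (RanSpace ha hd) :=
  inferInstanceAs (Module ℂ (LinearMap.range a.toFun))

/-- The inclusion of `ran a` in `H`. -/
def RanSpace.incl : RanSpace ha hd →ₗ[ℂ] H := (LinearMap.range a.toFun).subtype

/-- A vector `x ∈ dom a` with `ax = u`. -/
def RanSpace.preimage (u : RanSpace ha hd) : a.domain := (LinearMap.mem_range.1 u.2).choose

theorem RanSpace.apply_preimage (u : RanSpace ha hd) :
    a (RanSpace.preimage ha hd u) = RanSpace.incl ha hd u :=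
  (LinearMap.mem_range.1 u.2).choose_spec

/-- The inner product `⟨ax, ay⟩ = (ax, y)` on `ran a`; it does not depend on the choice of `y`
(see `RanSpace.inner_eq`), and it is definite because the form domain is dense. -/
@[reducible]
def RanSpace.core : InnerProductSpace.Core ℂ (RanSpace ha hd) where
  inner u v := inner ℂ (RanSpace.incl ha hd u) (RanSpace.preimage ha hd v : H)
  conj_inner_symm u v := by
    rw [inner_conj_symm, ← RanSpace.apply_preimage ha hd u, ← RanSpace.apply_preimage ha hd v,
      ha.symm]
  re_inner_nonneg u := by
    rw [← RanSpace.apply_preimage ha hd u]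
    exact ha.nonneg _
  add_left u v w := by rw [map_add, inner_add_left]
  smul_left u v r := by rw [map_smul, inner_smul_left]
  definite u hu := by
    have hu' : RanSpace.incl ha hd u = 0 := by
      refine hd.eq_zero_of_inner_left (𝕜 := ℂ) fun y hy => ?_
      obtain ⟨m, hm⟩ := hy
      have h := hm (RanSpace.preimage ha hd u)
      rw [RanSpace.apply_preimage, hu] at h
      simpa using h
    exact Subtype.ext hu'

instance : NormedAddCommGroup (RanSpace ha hd) := (RanSpace.core ha hd).toNormedAddCommGroup

instance : InnerProductSpace ℂ (RanSpace ha hd) :=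
  InnerProductSpace.ofCore (RanSpace.core ha hd).toCore

/-- The element `ax` of `ran a`. -/
def RanSpace.mk (x : a.domain) : RanSpace ha hd := ⟨a x, LinearMap.mem_range_self a.toFun x⟩

theorem RanSpace.inner_eq (x y : a.domain) :
    inner ℂ (RanSpace.mk ha hd x) (RanSpace.mk ha hd y) = inner ℂ (a x) (y : H) := by
  have h : a (RanSpace.preimage ha hd (RanSpace.mk ha hd y)) = a y :=
    RanSpace.apply_preimage ha hd _
  change inner ℂ (a x) (RanSpace.preimage ha hd (RanSpace.mk ha hd y) : H) = _
  rw [ha.symm, h, ha.symm]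

/-- The Hilbert space `H_a`: the completion of `ran a` for the inner product `⟨ax, ay⟩ = (ax, y)`. -/
abbrev EnergySpace : Type _ := UniformSpace.Completion (RanSpace ha hd)

variable (hb : IsPositiveSymmetric b) (hdb : Dense (formDomain b))

/-- The embedding of `ran a ⊕ ran b` in the Hilbert space direct sum `H_a ⊕ H_b`. -/
def ranSumEmbedding : RanSpace ha hd × RanSpace hb hdb →ₗ[ℂ]
    WithLp 2 (EnergySpace ha hd × EnergySpace hb hdb) :=
  (WithLp.linearEquiv 2 ℂ (EnergySpace ha hd × EnergySpace hb hdb)).symm.toLinearMap ∘ₗ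
    LinearMap.prodMap
      (UniformSpace.Completion.toComplₗᵢ (𝕜 := ℂ) (E := RanSpace ha hd)).toLinearMap
      (UniformSpace.Completion.toComplₗᵢ (𝕜 := ℂ) (E := RanSpace hb hdb)).toLinearMap

theorem ranSumEmbedding_injective : Function.Injective (ranSumEmbedding ha hd hb hdb) := by
  refine (WithLp.linearEquiv 2 ℂ
    (EnergySpace ha hd × EnergySpace hb hdb)).symm.injective.comp ?_
  exact Function.Injective.prodMap
    (UniformSpace.Completion.toComplₗᵢ (𝕜 := ℂ) (E := RanSpace ha hd)).injective
    (UniformSpace.Completion.toComplₗᵢ (𝕜 := ℂ) (E := RanSpace hb hdb)).injective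

/-- The operator `J : H_a ⊕ H_b → H` with `dom J = ran a ⊕ ran b` and `J (ax ⊕ by) = ax + by`. -/
def sumOperator (hab : Dense (formDomain a ∩ formDomain b)) :
    WithLp 2 (EnergySpace ha (hab.mono Set.inter_subset_left) ×
      EnergySpace hb (hab.mono Set.inter_subset_right)) →ₗ.[ℂ] H where
  domain := LinearMap.range (ranSumEmbedding ha (hab.mono Set.inter_subset_left) hb
    (hab.mono Set.inter_subset_right))
  toFun := LinearMap.coprod (RanSpace.incl ha _) (RanSpace.incl hb _) ∘ₗ
    (LinearEquiv.ofInjective _ (ranSumEmbedding_injective ha (hab.mono Set.inter_subset_left) hb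
      (hab.mono Set.inter_subset_right))).symm.toLinearMap

theorem sumOperator_apply (hab : Dense (formDomain a ∩ formDomain b)) (x : a.domain)
    (y : b.domain) :
    sumOperator ha hb hab ⟨ranSumEmbedding ha _ hb _ (RanSpace.mk ha _ x, RanSpace.mk hb _ y),
      LinearMap.mem_range_self _ _⟩ = a x + b y := by
  change LinearMap.coprod (RanSpace.incl ha _) (RanSpace.incl hb _)
    ((LinearEquiv.ofInjective _ (ranSumEmbedding_injective ha _ hb _)).symm
      (LinearEquiv.ofInjective _ (ranSumEmbedding_injective ha _ hb _)
        (RanSpace.mk ha _ x, RanSpace.mk hb _ y))) = _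
  rw [LinearEquiv.symm_apply_apply]
  rfl

end EnergySpace

/-- The product `g f` of two unbounded operators, defined on all `x ∈ dom f` with `f x ∈ dom g`. -/
def product {E F G : Type*} [AddCommGroup E] [Module ℂ E] [AddCommGroup F] [Module ℂ F]
    [AddCommGroup G] [Module ℂ G] (g : F →ₗ.[ℂ] G) (f : E →ₗ.[ℂ] F) : E →ₗ.[ℂ] G :=
  g.comp (f.domRestrict ((g.domain.comap f.toFun).map f.domain.subtype)) (by
    rintro ⟨x, hx⟩
    obtain ⟨hx₁, hx₂⟩ := Submodule.mem_inf.1 hx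
    obtain ⟨y, hy, rfl⟩ := Submodule.mem_map.1 hx₁
    exact hy)

theorem mem_product_domain {E F G : Type*} [AddCommGroup E] [Module ℂ E] [AddCommGroup F]
    [Module ℂ F] [AddCommGroup G] [Module ℂ G] (g : F →ₗ.[ℂ] G) (f : E →ₗ.[ℂ] F) (x : E) :
    x ∈ (product g f).domain ↔ ∃ hx : x ∈ f.domain, f ⟨x, hx⟩ ∈ g.domain := by
  constructor
  · intro hx
    obtain ⟨hx₁, hx₂⟩ := Submodule.mem_inf.1 hx
    obtain ⟨y, hy, rfl⟩ := Submodule.mem_map.1 hx₁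
    exact ⟨y.2, hy⟩
  · rintro ⟨hx, h⟩
    exact Submodule.mem_inf.2 ⟨Submodule.mem_map.2 ⟨⟨x, hx⟩, h, rfl⟩, hx⟩

theorem product_apply {E F G : Type*} [AddCommGroup E] [Module ℂ E] [AddCommGroup F]
    [Module ℂ F] [AddCommGroup G] [Module ℂ G] (g : F →ₗ.[ℂ] G) (f : E →ₗ.[ℂ] F) (x : E)
    (hx : x ∈ f.domain) (h : f ⟨x, hx⟩ ∈ g.domain) :
    product g f ⟨x, (mem_product_domain g f x).2 ⟨hx, h⟩⟩ = g ⟨f ⟨x, hx⟩, h⟩ := rfl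

variable [CompleteSpace H]

/-- Positive selfadjoint operators; selfadjointness includes that the domain is dense. -/
structure IsPositiveSelfAdjoint (A : H →ₗ.[ℂ] H) : Prop where
  selfAdjoint : IsSelfAdjoint A
  nonneg : ∀ x : A.domain, 0 ≤ (inner ℂ (A x) (x : H)).re

/-- `R` is a positive selfadjoint square root of `A`. -/
def IsSqrt (R A : H →ₗ.[ℂ] H) : Prop := IsPositiveSelfAdjoint R ∧ product R R = A

open scoped Classical in
/-- The positive selfadjoint square root of a positive selfadjoint operator (which exists and is
unique; for other operators the value is irrelevant). -/
def sqrt (A : H →ₗ.[ℂ] H) : H →ₗ.[ℂ] H := if h : ∃ R, IsSqrt R A then h.choose else ⊥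

/-- The order of positive selfadjoint operators: `A ≤ B` if `dom B^(1/2) ⊆ dom A^(1/2)` and
`‖A^(1/2) x‖ ≤ ‖B^(1/2) x‖` for all `x ∈ dom B^(1/2)`. -/
def FormLE (A B : H →ₗ.[ℂ] H) : Prop :=
  ∀ (x : H) (hB : x ∈ (sqrt B).domain),
    ∃ hA : x ∈ (sqrt A).domain, ‖sqrt A ⟨x, hA⟩‖ ≤ ‖sqrt B ⟨x, hB⟩‖

/-- `T` is the Krein-von Neumann extension of `a`: the smallest positive selfadjoint extension. -/
structure IsKreinVonNeumannExtension (a T : H →ₗ.[ℂ] H) : Prop where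
  positiveSelfAdjoint : IsPositiveSelfAdjoint T
  extends_op : a ≤ T
  least : ∀ S : H →ₗ.[ℂ] H, IsPositiveSelfAdjoint S → a ≤ S → FormLE T S

/-- The graph of the operator associated with the form `q_A + q_B`, where
`q_A (x, y) = (A^(1/2) x, A^(1/2) y)`: all pairs `(x, z)` such that `x` lies in
`D = dom A^(1/2) ∩ dom B^(1/2)` and `q_A (y, x) + q_B (y, x) = (y, z)` for all `y ∈ D`. -/
def formSumGraph (A B : H →ₗ.[ℂ] H) : Submodule ℂ (H × H) where
  carrier := {p | ∃ (hA : p.1 ∈ (sqrt A).domain) (hB : p.1 ∈ (sqrt B).domain),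
    ∀ (y : H) (kA : y ∈ (sqrt A).domain) (kB : y ∈ (sqrt B).domain),
      inner ℂ (sqrt A ⟨y, kA⟩) (sqrt A ⟨p.1, hA⟩) + inner ℂ (sqrt B ⟨y, kB⟩) (sqrt B ⟨p.1, hB⟩) =
        inner ℂ y p.2}
  zero_mem' := by
    refine ⟨Submodule.zero_mem _, Submodule.zero_mem _, fun y kA kB => ?_⟩
    have h₁ : sqrt A ⟨(0 : H × H).1, Submodule.zero_mem _⟩ = 0 := (sqrt A).map_zero
    have h₂ : sqrt B ⟨(0 : H × H).1, Submodule.zero_mem _⟩ = 0 := (sqrt B).map_zero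
    rw [h₁, h₂]
    simp
  add_mem' := by
    rintro p q ⟨hA, hB, h⟩ ⟨hA', hB', h'⟩
    refine ⟨Submodule.add_mem _ hA hA', Submodule.add_mem _ hB hB', fun y kA kB => ?_⟩
    have h₁ : sqrt A ⟨(p + q).1, Submodule.add_mem _ hA hA'⟩ = sqrt A ⟨p.1, hA⟩ + sqrt A ⟨q.1, hA'⟩ :=
      (sqrt A).map_add ⟨p.1, hA⟩ ⟨q.1, hA'⟩
    have h₂ : sqrt B ⟨(p + q).1, Submodule.add_mem _ hB hB'⟩ = sqrt B ⟨p.1, hB⟩ + sqrt B ⟨q.1, hB'⟩ :=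
      (sqrt B).map_add ⟨p.1, hB⟩ ⟨q.1, hB'⟩
    rw [h₁, h₂, inner_add_right, inner_add_right, Prod.snd_add, inner_add_right, ← h y kA kB,
      ← h' y kA kB]
    ring
  smul_mem' := by
    rintro c p ⟨hA, hB, h⟩
    refine ⟨Submodule.smul_mem _ c hA, Submodule.smul_mem _ c hB, fun y kA kB => ?_⟩
    have h₁ : sqrt A ⟨(c • p).1, Submodule.smul_mem _ c hA⟩ = c • sqrt A ⟨p.1, hA⟩ :=
      (sqrt A).map_smul c ⟨p.1, hA⟩
    have h₂ : sqrt B ⟨(c • p).1, Submodule.smul_mem _ c hB⟩ = c • sqrt B ⟨p.1, hB⟩ :=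
      (sqrt B).map_smul c ⟨p.1, hB⟩
    rw [h₁, h₂, inner_smul_right, inner_smul_right, Prod.smul_snd, inner_smul_right, ← h y kA kB]
    ring

theorem formSumGraph_singleValued (A B : H →ₗ.[ℂ] H)
    (hD : Dense (((sqrt A).domain ⊓ (sqrt B).domain : Submodule ℂ H) : Set H)) :
    ∀ p ∈ formSumGraph A B, p.1 = 0 → p.2 = 0 := by
  rintro ⟨x, z⟩ ⟨hA, hB, h⟩ hx
  have hx' : x = 0 := hx
  subst hx'
  refine hD.eq_zero_of_inner_right (𝕜 := ℂ) fun y hy => ?_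
  have h₁ : sqrt A ⟨0, hA⟩ = 0 := (sqrt A).map_zero
  have h₂ : sqrt B ⟨0, hB⟩ = 0 := (sqrt B).map_zero
  have := h y hy.1 hy.2
  simpa [h₁, h₂] using this.symm

/-- The form sum of positive selfadjoint operators `A`, `B` for which
`dom A^(1/2) ∩ dom B^(1/2)` is dense: the operator that the representation theorem associates with
the closed form `q_A + q_B`. Its graph is single-valued by `formSumGraph_singleValued`. -/
def formSum (A B : H →ₗ.[ℂ] H) : H →ₗ.[ℂ] H := (formSumGraph A B).toLinearPMap

end

end FormSum

/-
Let `J_a : H_a → H` be the inclusion of `ran a`. The seminorm `⟨ax, ax⟩^(1/2)` on `ran a` controls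
`(ax, y)` exactly when `y ∈ D_*(a)`, so `J_a*` has domain `D_*(a)` and is densely defined. The
operator `J_a** J_a*` is selfadjoint by a theorem of von Neumann and extends `a`, and `‖J_a* y‖` is
the least `c` with `|(ax, y)| ≤ c ⟨ax, ax⟩^(1/2)`. For a positive selfadjoint `S ⊇ a` the
Cauchy–Schwarz inequality `|(ax, y)| ≤ ‖S^(1/2) y‖ ⟨ax, ax⟩^(1/2)` bounds this `c`, whence
`J_a** J_a* = a_K`.

For closed densely defined `T` and `R`, `T* T = R* R` if and only if `T` and `R` define the same
form. Hence `a_K^(1/2)` and `J_a*` define the same form. Finally `J* = J_a* ⊕ J_b*`, so `J** J*` is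
the operator associated with `‖J_a* x‖² + ‖J_b* x‖²`, the sum of the forms of `a_K` and `b_K`.
-/

namespace FormSum

open LinearPMap hiding map_add map_zero map_smul
open Filter
open scoped InnerProductSpace LinearPMap Topology

section CompInv

variable {R V E F : Type*} [Ring R] [AddCommGroup V] [Module R V] [AddCommGroup E] [Module R E]
  [AddCommGroup F] [Module R F]

/-- The operator `f ∘ ι⁻¹` with domain `ran ι`. The operators `J`, `J_a` and `(1 - B) B⁻¹` of the
development all have this shape. -/
noncomputable def compInv (f : V →ₗ[R] F) (ι : V →ₗ[R] E) (hι : Function.Injective ι) :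
    E →ₗ.[R] F where
  domain := LinearMap.range ι
  toFun := f ∘ₗ (LinearEquiv.ofInjective ι hι).symm.toLinearMap

variable {f : V →ₗ[R] F} {ι : V →ₗ[R] E} {hι : Function.Injective ι}

theorem compInv_apply (v : V) : compInv f ι hι ⟨ι v, LinearMap.mem_range_self ι v⟩ = f v :=
  congrArg f ((LinearEquiv.ofInjective ι hι).symm_apply_apply v)

theorem forall_compInv_domain {p : (compInv f ι hι).domain → Prop} :
    (∀ x, p x) ↔ ∀ v, p ⟨ι v, LinearMap.mem_range_self ι v⟩ :=
  ⟨fun h _ => h _, by rintro h ⟨_, v, rfl⟩; exact h v⟩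

theorem mem_graph_compInv {x : E} {z : F} :
    (x, z) ∈ (compInv f ι hι).graph ↔ ∃ v, ι v = x ∧ f v = z := by
  rw [mem_graph_iff]
  constructor
  · rintro ⟨⟨_, v, rfl⟩, rfl, rfl⟩
    exact ⟨v, rfl, (compInv_apply v).symm⟩
  · rintro ⟨v, rfl, rfl⟩
    exact ⟨_, rfl, compInv_apply v⟩

end CompInv

section Adjoint

variable {𝕜 E F : Type*} [RCLike 𝕜] [NormedAddCommGroup E] [InnerProductSpace 𝕜 E]
  [CompleteSpace E] [NormedAddCommGroup F] [InnerProductSpace 𝕜 F]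

theorem dense_of_forall_inner_eq_zero {S : Submodule 𝕜 E}
    (h : ∀ y, (∀ x ∈ S, ⟪x, y⟫_𝕜 = 0) → y = 0) : Dense (S : Set E) := by
  rw [Submodule.dense_iff_topologicalClosure_eq_top, Submodule.topologicalClosure_eq_top_iff,
    Submodule.eq_bot_iff]
  exact fun y hy => h y ((Submodule.mem_orthogonal S y).1 hy)

theorem denseRange_of_isSelfAdjoint_of_injective {C : E →L[𝕜] E} (hC : IsSelfAdjoint C)
    (hinj : Function.Injective C) : DenseRange C := by
  refine dense_of_forall_inner_eq_zero (S := C.range) fun y hy => hinj ?_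
  rw [map_zero, ← inner_self_eq_zero (𝕜 := 𝕜)]
  exact (hC.isSymmetric (C y) y).symm.trans (hy _ ⟨C y, rfl⟩)

theorem mem_graph_adjoint_iff {T : E →ₗ.[𝕜] F} (hT : Dense (T.domain : Set E)) {y : F} {z : E} :
    (y, z) ∈ T†.graph ↔ ∀ x : T.domain, ⟪T x, y⟫_𝕜 = ⟪(x : E), z⟫_𝕜 := by
  rw [adjoint_graph_eq_graph_adjoint hT, Submodule.mem_adjoint_iff]
  constructor
  · exact fun h x => sub_eq_zero.1 (h x (T x) (T.mem_graph x))
  · intro h x w hxw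
    obtain ⟨u, rfl, rfl⟩ := (mem_graph_iff T).1 hxw
    exact sub_eq_zero.2 (h u)

theorem exists_norm_adjoint_apply_le {T : E →ₗ.[𝕜] F} (hT : Dense (T.domain : Set E)) {y : F}
    {c : ℝ} (hc : 0 ≤ c) (h : ∀ x : T.domain, ‖⟪T x, y⟫_𝕜‖ ≤ c * ‖(x : E)‖) :
    ∃ hy : y ∈ T†.domain, ‖T† ⟨y, hy⟩‖ ≤ c := by
  have hy : y ∈ T†.domain := (mem_adjoint_domain_iff T y).2 <|
    AddMonoidHomClass.continuous_of_bound _ c fun x => (norm_inner_symm y (T x)).trans_le (h x)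
  refine ⟨hy, ?_⟩
  set w := T† ⟨y, hy⟩
  have hw : ∀ v : E, ‖⟪v, w⟫_𝕜‖ ≤ c * ‖v‖ := by
    refine hT.induction (fun v hv => ?_) (isClosed_le (by fun_prop) (by fun_prop))
    rw [← (mem_graph_adjoint_iff hT).1 (T†.mem_graph ⟨y, hy⟩) ⟨v, hv⟩]
    exact h ⟨v, hv⟩
  rw [← innerSL_apply_norm (𝕜 := 𝕜)]
  exact ContinuousLinearMap.opNorm_le_bound _ hc fun v => by
    rw [innerSL_apply_apply, norm_inner_symm]; exact hw v

theorem mem_graph_adjoint_compInv {V : Type*} [AddCommGroup V] [Module 𝕜 V] {f : V →ₗ[𝕜] F}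
    {ι : V →ₗ[𝕜] E} {hι : Function.Injective ι} (hd : DenseRange ι) {y : F} {z : E} :
    (y, z) ∈ (compInv f ι hι)†.graph ↔ ∀ v, ⟪f v, y⟫_𝕜 = ⟪ι v, z⟫_𝕜 := by
  rw [mem_graph_adjoint_iff (T := compInv f ι hι) (by exact hd), forall_compInv_domain]
  simp only [compInv_apply]

end Adjoint

section SameForm

variable {𝕜 E F F' G G' : Type*} [NormedField 𝕜] [AddCommGroup E] [Module 𝕜 E]
  [NormedAddCommGroup F] [NormedSpace 𝕜 F] [NormedAddCommGroup F'] [NormedSpace 𝕜 F']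
  [NormedAddCommGroup G] [NormedSpace 𝕜 G] [NormedAddCommGroup G'] [NormedSpace 𝕜 G']

/-- The operators `T` and `R` define the same quadratic form: `‖T x‖² = ‖R x‖²`, with equal
domains. -/
structure SameForm (T : E →ₗ.[𝕜] F) (R : E →ₗ.[𝕜] G) : Prop where
  domain_eq : T.domain = R.domain
  norm_eq : ∀ ⦃x : T.domain⦄ ⦃y : R.domain⦄, (x : E) = y → ‖T x‖ = ‖R y‖

/-- The operator `x ↦ T x ⊕ R x` on `dom T ∩ dom R`; its form is the sum of the forms of `T` and
`R`. -/
noncomputable def pair (T : E →ₗ.[𝕜] F) (R : E →ₗ.[𝕜] G) : E →ₗ.[𝕜] WithLp 2 (F × G) where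
  domain := T.domain ⊓ R.domain
  toFun := (WithLp.linearEquiv 2 𝕜 (F × G)).symm.toLinearMap ∘ₗ
    (T.toFun ∘ₗ Submodule.inclusion inf_le_left).prod (R.toFun ∘ₗ Submodule.inclusion inf_le_right)

theorem mem_graph_pair {T : E →ₗ.[𝕜] F} {R : E →ₗ.[𝕜] G} {x : E} {w : WithLp 2 (F × G)} :
    (x, w) ∈ (pair T R).graph ↔ (x, w.fst) ∈ T.graph ∧ (x, w.snd) ∈ R.graph := by
  simp only [mem_graph_iff]
  constructor
  · rintro ⟨u, rfl, rfl⟩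
    exact ⟨⟨⟨u, u.2.1⟩, rfl, rfl⟩, ⟨⟨u, u.2.2⟩, rfl, rfl⟩⟩
  · rintro ⟨⟨⟨_, hT⟩, rfl, hw₁⟩, ⟨⟨_, hR⟩, rfl, hw₂⟩⟩
    exact ⟨⟨_, hT, hR⟩, rfl, WithLp.ofLp_injective 2 (Prod.ext hw₁ hw₂)⟩

theorem SameForm.pair {T : E →ₗ.[𝕜] F} {T' : E →ₗ.[𝕜] F'} {R : E →ₗ.[𝕜] G} {R' : E →ₗ.[𝕜] G'}
    (hT : SameForm T T') (hR : SameForm R R') : SameForm (pair T R) (pair T' R') where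
  domain_eq := congrArg₂ (· ⊓ ·) hT.domain_eq hR.domain_eq
  norm_eq x y hxy := by
    have hT' : ‖T ⟨x, x.2.1⟩‖ = ‖T' ⟨y, y.2.1⟩‖ := hT.norm_eq hxy
    have hR' : ‖R ⟨x, x.2.2⟩‖ = ‖R' ⟨y, y.2.2⟩‖ := hR.norm_eq hxy
    rw [← sq_eq_sq₀ (norm_nonneg _) (norm_nonneg _), WithLp.prod_norm_sq_eq_of_L2,
      WithLp.prod_norm_sq_eq_of_L2]
    exact congrArg₂ (fun r s : ℝ => r ^ 2 + s ^ 2) hT' hR'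

end SameForm

theorem SameForm.inner_eq {𝕜 E F G : Type*} [RCLike 𝕜] [AddCommGroup E] [Module 𝕜 E]
    [NormedAddCommGroup F] [InnerProductSpace 𝕜 F] [NormedAddCommGroup G] [InnerProductSpace 𝕜 G]
    {T : E →ₗ.[𝕜] F} {R : E →ₗ.[𝕜] G} (h : SameForm T R) {x y : T.domain} {x' y' : R.domain}
    (hx : (x : E) = x') (hy : (y : E) = y') : ⟪T x, T y⟫_𝕜 = ⟪R x', R y'⟫_𝕜 := by
  have hsmul (c : 𝕜) : ‖T x + c • T y‖ = ‖R x' + c • R y'‖ := by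
    rw [← LinearPMap.map_smul, ← LinearPMap.map_add, ← LinearPMap.map_smul, ← LinearPMap.map_add]
    exact h.norm_eq (by simp [hx, hy])
  have hadd := hsmul 1
  have hsub := hsmul (-1)
  have haddI := hsmul RCLike.I
  have hsubI := hsmul (-RCLike.I)
  simp only [one_smul, neg_smul, ← sub_eq_add_neg] at hadd hsub haddI hsubI
  rw [inner_eq_sum_norm_sq_div_four, inner_eq_sum_norm_sq_div_four, hadd, hsub, haddI, hsubI]

section Core

variable {𝕜 E F G : Type*} [NormedField 𝕜] [NormedAddCommGroup E] [NormedSpace 𝕜 E]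
  [NormedAddCommGroup F] [NormedSpace 𝕜 F] [NormedAddCommGroup G] [NormedSpace 𝕜 G]

theorem exists_mem_graph_of_mem_closure [CompleteSpace G] {S : Submodule 𝕜 (E × F)}
    {R : E →ₗ.[𝕜] G} (hR : R.IsClosed)
    (hS : ∀ p ∈ S, ∃ w, (p.1, w) ∈ R.graph ∧ ‖w‖ = ‖p.2‖) {p : E × F}
    (hp : p ∈ closure (S : Set (E × F))) : ∃ w, (p.1, w) ∈ R.graph ∧ ‖w‖ = ‖p.2‖ := by
  obtain ⟨q, hq, hlim⟩ := mem_closure_iff_seq_limit.1 hp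
  have hlim₁ : Tendsto (fun n => (q n).1) atTop (𝓝 p.1) := (continuous_fst.tendsto p).comp hlim
  have hlim₂ : Tendsto (fun n => (q n).2) atTop (𝓝 p.2) := (continuous_snd.tendsto p).comp hlim
  choose w hw hnorm using fun n => hS (q n) (hq n)
  have hdist (m n : ℕ) : dist (w m) (w n) = dist (q m).2 (q n).2 := by
    obtain ⟨v, hv, hvn⟩ := hS _ (S.sub_mem (hq m) (hq n))
    rw [dist_eq_norm, dist_eq_norm, ← Prod.snd_sub, ← hvn,
      mem_graph_snd_inj R hv (R.graph.sub_mem (hw m) (hw n)) rfl]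
  have hcauchy : CauchySeq w := by
    simpa only [Metric.cauchySeq_iff, hdist] using hlim₂.cauchySeq
  obtain ⟨w₀, hw₀⟩ := cauchySeq_tendsto_of_complete hcauchy
  refine ⟨w₀, hR.mem_of_tendsto (hlim₁.prodMk_nhds hw₀) (Eventually.of_forall hw),
    tendsto_nhds_unique hw₀.norm ?_⟩
  simpa only [hnorm] using hlim₂.norm

theorem exists_norm_eq_of_hasCore [CompleteSpace G] {T : E →ₗ.[𝕜] F} {R : E →ₗ.[𝕜] G}
    {D : Submodule 𝕜 E} (hTc : T.IsClosed) (hRc : R.IsClosed) (hT : T.HasCore D)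
    (hDR : D ≤ R.domain)
    (hnorm : ∀ ⦃x : T.domain⦄ ⦃y : R.domain⦄, (x : E) ∈ D → (x : E) = y → ‖T x‖ = ‖R y‖)
    (x : T.domain) : ∃ hx : (x : E) ∈ R.domain, ‖R ⟨x, hx⟩‖ = ‖T x‖ := by
  have hx : ((x : E), T x) ∈ closure ((T.domRestrict D).graph : Set (E × F)) := by
    rw [← Submodule.topologicalClosure_coe, (hTc.isClosable.leIsClosable
      domRestrict_le).graph_closure_eq_closure_graph, hT.closure_eq]
    exact T.mem_graph x
  have hS : ∀ p ∈ (T.domRestrict D).graph, ∃ w, (p.1, w) ∈ R.graph ∧ ‖w‖ = ‖p.2‖ := by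
    rintro ⟨_, _⟩ hp
    obtain ⟨⟨u, huD, huT⟩, rfl, rfl⟩ := (mem_graph_iff _).1 hp
    exact ⟨R ⟨u, hDR huD⟩, R.mem_graph ⟨u, hDR huD⟩, (hnorm (x := ⟨u, huT⟩) huD rfl).symm⟩
  obtain ⟨w, hw, hwn⟩ := exists_mem_graph_of_mem_closure hRc hS hx
  obtain ⟨⟨_, hx'⟩, rfl, hRw⟩ := (mem_graph_iff R).1 hw
  exact ⟨hx', (congrArg norm hRw).trans hwn⟩

theorem SameForm.of_hasCore [CompleteSpace F] [CompleteSpace G] {T : E →ₗ.[𝕜] F}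
    {R : E →ₗ.[𝕜] G} {D : Submodule 𝕜 E} (hTc : T.IsClosed) (hRc : R.IsClosed)
    (hT : T.HasCore D) (hR : R.HasCore D)
    (hnorm : ∀ ⦃x : T.domain⦄ ⦃y : R.domain⦄, (x : E) ∈ D → (x : E) = y → ‖T x‖ = ‖R y‖) :
    SameForm T R := by
  have hTR := exists_norm_eq_of_hasCore hTc hRc hT hR.le_domain hnorm
  have hRT := exists_norm_eq_of_hasCore hRc hTc hR hT.le_domain
    fun x y hx hxy => (hnorm (hxy ▸ hx) hxy.symm).symm
  refine ⟨le_antisymm (fun x hx => (hTR ⟨x, hx⟩).1) (fun x hx => (hRT ⟨x, hx⟩).1), ?_⟩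
  rintro x ⟨_, _⟩ rfl
  exact (hTR x).2.symm

end Core

theorem mem_graph_product {E F G : Type*} [AddCommGroup E] [Module ℂ E] [AddCommGroup F]
    [Module ℂ F] [AddCommGroup G] [Module ℂ G] {g : F →ₗ.[ℂ] G} {f : E →ₗ.[ℂ] F} {x : E} {z : G} :
    (x, z) ∈ (product g f).graph ↔ ∃ y, (x, y) ∈ f.graph ∧ (y, z) ∈ g.graph := by
  simp only [mem_graph_iff]
  constructor
  · rintro ⟨⟨x', hx'⟩, rfl, rfl⟩
    obtain ⟨hx, h⟩ := (mem_product_domain g f x').1 hx'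
    exact ⟨_, ⟨⟨x', hx⟩, rfl, rfl⟩, ⟨⟨_, h⟩, rfl, rfl⟩⟩
  · rintro ⟨y, ⟨⟨x', hx⟩, rfl, rfl⟩, ⟨⟨y', hy⟩, hy', rfl⟩⟩
    obtain rfl : y' = f ⟨x', hx⟩ := hy'
    exact ⟨⟨x', (mem_product_domain g f x').2 ⟨hx, hy⟩⟩, rfl, rfl⟩

section OneAdd

variable {H : Type*} [NormedAddCommGroup H] [InnerProductSpace ℂ H] {A : H →ₗ.[ℂ] H}

/-- The operator `1 + A` as a linear map on `dom A`; for positive symmetric `A` its surjectivity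
characterizes selfadjointness. -/
noncomputable def oneAdd (A : H →ₗ.[ℂ] H) : A.domain →ₗ[ℂ] H := A.domain.subtype + A.toFun

theorem oneAdd_apply (x : A.domain) : oneAdd A x = x + A x := rfl

theorem norm_sq_add_norm_apply_sq_le (hA : ∀ x : A.domain, 0 ≤ (⟪A x, (x : H)⟫_ℂ).re)
    (x : A.domain) : ‖(x : H)‖ ^ 2 + ‖A x‖ ^ 2 ≤ ‖oneAdd A x‖ ^ 2 := by
  have hexpand : ‖A x + x‖ ^ 2 = ‖A x‖ ^ 2 + 2 * (⟪A x, (x : H)⟫_ℂ).re + ‖(x : H)‖ ^ 2 :=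
    norm_add_sq (𝕜 := ℂ) (A x) (x : H)
  rw [oneAdd_apply, add_comm (x : H), hexpand]
  linarith [hA x]

theorem norm_le_norm_oneAdd (hA : ∀ x : A.domain, 0 ≤ (⟪A x, (x : H)⟫_ℂ).re) (x : A.domain) :
    ‖(x : H)‖ ≤ ‖oneAdd A x‖ :=
  (sq_le_sq₀ (norm_nonneg _) (norm_nonneg _)).1 <|
    (le_add_of_nonneg_right (sq_nonneg _)).trans (norm_sq_add_norm_apply_sq_le hA x)

theorem norm_apply_le_norm_oneAdd (hA : ∀ x : A.domain, 0 ≤ (⟪A x, (x : H)⟫_ℂ).re) (x : A.domain) :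
    ‖A x‖ ≤ ‖oneAdd A x‖ :=
  (sq_le_sq₀ (norm_nonneg _) (norm_nonneg _)).1 <|
    (le_add_of_nonneg_left (sq_nonneg _)).trans (norm_sq_add_norm_apply_sq_le hA x)

theorem oneAdd_injective (hA : ∀ x : A.domain, 0 ≤ (⟪A x, (x : H)⟫_ℂ).re) :
    Function.Injective (oneAdd A) := by
  refine (injective_iff_map_eq_zero _).2 fun x hx => Subtype.ext (norm_le_zero_iff.1 ?_)
  simpa only [hx, norm_zero] using norm_le_norm_oneAdd hA x

theorem IsPositiveSymmetric.inner_oneAdd_left (hA : IsPositiveSymmetric A) (x y : A.domain) :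
    ⟪oneAdd A x, (y : H)⟫_ℂ = ⟪(x : H), oneAdd A y⟫_ℂ := by
  rw [oneAdd_apply, oneAdd_apply, inner_add_left, inner_add_right, hA.symm]

variable [CompleteSpace H]

theorem IsPositiveSymmetric.dense_domain_of_surjective (hA : IsPositiveSymmetric A)
    (hsurj : Function.Surjective (oneAdd A)) : Dense (A.domain : Set H) := by
  refine dense_of_forall_inner_eq_zero fun y hy => ?_
  obtain ⟨x, rfl⟩ := hsurj y
  have hx : (x : H) = 0 := by
    have h := congrArg Complex.re (hy x x.2)
    rw [← hA.inner_oneAdd_left, oneAdd_apply, inner_add_left, Complex.add_re, Complex.zero_re,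
      show (⟪(x : H), x⟫_ℂ).re = ‖(x : H)‖ ^ 2 from inner_self_eq_norm_sq (𝕜 := ℂ) (x : H)] at h
    exact norm_eq_zero.1 (sq_eq_zero_iff.1 (by linarith [hA.nonneg x, sq_nonneg ‖(x : H)‖]))
  rw [Subtype.ext hx (a2 := (0 : A.domain)), map_zero]

theorem IsPositiveSymmetric.isPositiveSelfAdjoint_of_surjective (hA : IsPositiveSymmetric A)
    (hsurj : Function.Surjective (oneAdd A)) : IsPositiveSelfAdjoint A := by
  have hd := hA.dense_domain_of_surjective hsurj
  refine ⟨isSelfAdjoint_def.2 (le_antisymm (le_of_le_graph ?_) ?_), hA.nonneg⟩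
  · rintro ⟨y, w⟩ hyw
    obtain ⟨x, hx⟩ := hsurj (y + w)
    have horth (u : A.domain) : ⟪oneAdd A u, y - x⟫_ℂ = 0 := by
      rw [inner_sub_right, hA.inner_oneAdd_left, hx, oneAdd_apply, inner_add_left,
        inner_add_right, (mem_graph_adjoint_iff hd).1 hyw, sub_self]
    obtain ⟨u, hu⟩ := hsurj (y - x)
    obtain rfl : y = x := sub_eq_zero.1 (inner_self_eq_zero.1 (hu ▸ horth u))
    rw [add_left_cancel (hx.symm.trans (oneAdd_apply x))]
    exact A.mem_graph x
  · exact IsFormalAdjoint.le_adjoint hd hA.symm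

theorem IsPositiveSelfAdjoint.isPositiveSymmetric (hA : IsPositiveSelfAdjoint A) :
    IsPositiveSymmetric A where
  symm x y := by
    have h : ((y : H), A y) ∈ A†.graph := by
      rw [isSelfAdjoint_def.1 hA.selfAdjoint]
      exact A.mem_graph y
    exact (mem_graph_adjoint_iff hA.selfAdjoint.dense_domain).1 h x
  nonneg := hA.nonneg

theorem isClosed_range_oneAdd (hA : ∀ x : A.domain, 0 ≤ (⟪A x, (x : H)⟫_ℂ).re)
    (hc : A.IsClosed) : IsClosed (LinearMap.range (oneAdd A) : Set H) := by
  have : CompleteSpace A.graph := IsClosed.completeSpace_coe (hs := hc)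
  let f : A.graph →L[ℂ] H :=
    (ContinuousLinearMap.fst ℂ H H + ContinuousLinearMap.snd ℂ H H) ∘L A.graph.subtypeL
  have hf (x : A.domain) : f ⟨(x, A x), A.mem_graph x⟩ = oneAdd A x := rfl
  have hanti : AntilipschitzWith 1 f := by
    refine AddMonoidHomClass.antilipschitz_of_bound f ?_
    rintro ⟨⟨_, _⟩, hp⟩
    obtain ⟨x, rfl, rfl⟩ := (mem_graph_iff A).1 hp
    rw [hf, NNReal.coe_one, one_mul]
    exact max_le (norm_le_norm_oneAdd hA x) (norm_apply_le_norm_oneAdd hA x)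
  convert hanti.isClosed_range f.uniformContinuous using 1
  ext h
  constructor
  · rintro ⟨x, rfl⟩
    exact ⟨_, hf x⟩
  · rintro ⟨⟨⟨_, _⟩, hp⟩, rfl⟩
    obtain ⟨x, rfl, rfl⟩ := (mem_graph_iff A).1 hp
    exact ⟨x, rfl⟩

theorem IsPositiveSelfAdjoint.surjective_oneAdd (hA : IsPositiveSelfAdjoint A) :
    Function.Surjective (oneAdd A) := by
  have hdense : Dense (LinearMap.range (oneAdd A) : Set H) := by
    refine dense_of_forall_inner_eq_zero fun y hy => ?_
    have hmem : (y, -y) ∈ A.graph := by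
      rw [← isSelfAdjoint_def.1 hA.selfAdjoint,
        mem_graph_adjoint_iff hA.selfAdjoint.dense_domain]
      intro x
      have hxy : ⟪(x : H) + A x, y⟫_ℂ = 0 := hy _ ⟨x, rfl⟩
      rw [inner_add_left] at hxy
      rw [inner_neg_right]
      exact eq_neg_of_add_eq_zero_right hxy
    obtain ⟨x, rfl, hx⟩ := (mem_graph_iff A).1 hmem
    have hx₀ : oneAdd A x = 0 := by rw [oneAdd_apply, hx, add_neg_cancel]
    rw [(injective_iff_map_eq_zero _).1 (oneAdd_injective hA.nonneg) x hx₀, Submodule.coe_zero]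
  refine Set.range_eq_univ.1 ?_
  rw [← LinearMap.coe_range, ← hdense.closure_eq,
    (isClosed_range_oneAdd hA.nonneg hA.selfAdjoint.isClosed).closure_eq]

end OneAdd

section HilbertGraph

variable {𝕜 H K : Type*} [NormedField 𝕜] [NormedAddCommGroup H] [NormedSpace 𝕜 H]
  [NormedAddCommGroup K] [NormedSpace 𝕜 K] {T : H →ₗ.[𝕜] K}

/-- The graph of `T` as a subspace of the Hilbert space `H ⊕ K`, where it has an orthogonal
complement. -/
def hilbertGraph (T : H →ₗ.[𝕜] K) : Submodule 𝕜 (WithLp 2 (H × K)) :=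
  T.graph.comap (WithLp.linearEquiv 2 𝕜 (H × K)).toLinearMap

theorem isClosed_hilbertGraph (hc : T.IsClosed) :
    IsClosed (hilbertGraph T : Set (WithLp 2 (H × K))) :=
  hc.preimage (WithLp.prod_continuous_ofLp 2 H K)

end HilbertGraph

section AdjointProduct

variable {H K L : Type*} [NormedAddCommGroup H] [InnerProductSpace ℂ H] [CompleteSpace H]
  [NormedAddCommGroup K] [InnerProductSpace ℂ K] [NormedAddCommGroup L] [InnerProductSpace ℂ L]
  {T : H →ₗ.[ℂ] K} {R : H →ₗ.[ℂ] L}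

theorem mem_graph_adjoint_product_iff (hT : Dense (T.domain : Set H)) {x z : H} :
    (x, z) ∈ (product T† T).graph ↔
      ∃ hx : x ∈ T.domain, ∀ y : T.domain, ⟪T y, T ⟨x, hx⟩⟫_ℂ = ⟪(y : H), z⟫_ℂ := by
  rw [mem_graph_product]
  constructor
  · rintro ⟨w, hw, h⟩
    obtain ⟨⟨x', hx⟩, rfl, rfl⟩ := (mem_graph_iff T).1 hw
    exact ⟨hx, (mem_graph_adjoint_iff hT).1 h⟩
  · rintro ⟨hx, h⟩
    exact ⟨_, T.mem_graph ⟨x, hx⟩, (mem_graph_adjoint_iff hT).2 h⟩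

theorem SameForm.adjoint_product_eq (h : SameForm T R) (hT : Dense (T.domain : Set H)) :
    product T† T = product R† R := by
  have hR : Dense (R.domain : Set H) := h.domain_eq ▸ hT
  obtain ⟨D, t⟩ := T
  obtain ⟨D', r⟩ := R
  obtain rfl : D = D' := h.domain_eq
  refine eq_of_eq_graph (Submodule.ext ?_)
  rintro ⟨x, z⟩
  rw [mem_graph_adjoint_product_iff hT, mem_graph_adjoint_product_iff hR]
  exact exists_congr fun hx => forall_congr' fun y => by
    rw [h.inner_eq (x' := y) (y' := ⟨x, hx⟩) rfl rfl]

theorem adjoint_product_le_domain : (product T† T).domain ≤ T.domain := fun x hx =>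
  ((mem_product_domain _ _ x).1 hx).1

theorem inner_adjoint_product_apply (hT : Dense (T.domain : Set H)) (y : T.domain)
    (x : (product T† T).domain) :
    ⟪(y : H), product T† T x⟫_ℂ = ⟪T y, T ⟨x, adjoint_product_le_domain x.2⟩⟫_ℂ :=
  (((mem_graph_adjoint_product_iff hT).1 ((product T† T).mem_graph x)).2 y).symm

theorem isPositiveSymmetric_adjoint_product (hT : Dense (T.domain : Set H)) :
    IsPositiveSymmetric (product T† T) where
  symm x y := by
    rw [inner_adjoint_product_apply hT ⟨x, adjoint_product_le_domain x.2⟩, ← inner_conj_symm,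
      inner_adjoint_product_apply hT ⟨y, adjoint_product_le_domain y.2⟩, inner_conj_symm]
  nonneg x := by
    rw [← inner_conj_symm, Complex.conj_re,
      inner_adjoint_product_apply hT ⟨x, adjoint_product_le_domain x.2⟩]
    exact inner_self_nonneg (𝕜 := ℂ)

variable [CompleteSpace K]

-- The graph component of `h ⊕ 0` is `x ⊕ T x` with `(1 + T* T) x = h`.
theorem surjective_oneAdd_adjoint_product (hT : Dense (T.domain : Set H)) (hc : T.IsClosed) :
    Function.Surjective (oneAdd (product T† T)) := by
  intro h
  have : CompleteSpace (hilbertGraph T) := (isClosed_hilbertGraph hc).completeSpace_coe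
  obtain ⟨p, hp, q, hq, hpq⟩ :=
    (hilbertGraph T).exists_add_mem_mem_orthogonal (WithLp.toLp 2 (h, 0))
  have hfst : h = p.fst + q.fst := congrArg WithLp.fst hpq
  have hsnd : 0 = p.snd + q.snd := congrArg WithLp.snd hpq
  have hadj : (p.snd, q.fst) ∈ T†.graph := by
    refine (mem_graph_adjoint_iff hT).2 fun x => ?_
    have horth : ⟪(x : H), q.fst⟫_ℂ + ⟪T x, q.snd⟫_ℂ = 0 :=
      (Submodule.mem_orthogonal _ _).1 hq (WithLp.toLp 2 (x, T x)) (T.mem_graph x)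
    rw [eq_neg_of_add_eq_zero_left hsnd.symm, inner_neg_right]
    exact (eq_neg_of_add_eq_zero_left horth).symm
  obtain ⟨x, hx, hx'⟩ := (mem_graph_iff _).1 (mem_graph_product.2 ⟨p.snd, hp, hadj⟩)
  exact ⟨x, (congrArg₂ (· + ·) hx hx').trans hfst.symm⟩

theorem isPositiveSelfAdjoint_adjoint_product (hT : Dense (T.domain : Set H)) (hc : T.IsClosed) :
    IsPositiveSelfAdjoint (product T† T) :=
  (isPositiveSymmetric_adjoint_product hT).isPositiveSelfAdjoint_of_surjective
    (surjective_oneAdd_adjoint_product hT hc)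

theorem eq_zero_of_forall_inner_add_inner_eq_zero (hT : Dense (T.domain : Set H)) (hc : T.IsClosed)
    {v : T.domain} (hv : ∀ u : (product T† T).domain,
      ⟪(v : H), u⟫_ℂ + ⟪T v, T ⟨u, adjoint_product_le_domain u.2⟩⟫_ℂ = 0) : v = 0 := by
  obtain ⟨u, hu⟩ := surjective_oneAdd_adjoint_product hT hc v
  refine Subtype.ext (inner_self_eq_zero (𝕜 := ℂ).1 ?_)
  nth_rewrite 2 [← hu]
  rw [oneAdd_apply, inner_add_right, inner_adjoint_product_apply hT, hv]

theorem mem_closure_graph_domRestrict_adjoint_product (hT : Dense (T.domain : Set H))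
    (hc : T.IsClosed) (x : T.domain) :
    ((x : H), T x) ∈ closure ((T.domRestrict (product T† T).domain).graph : Set (H × K)) := by
  set M := hilbertGraph (T.domRestrict (product T† T).domain)
  have hM : M ≤ hilbertGraph T := fun p hp => le_graph_of_le domRestrict_le hp
  have hMcl : M.topologicalClosure ≤ hilbertGraph T :=
    M.topologicalClosure_minimal hM (isClosed_hilbertGraph hc)
  have : CompleteSpace M.topologicalClosure := M.isClosed_topologicalClosure.completeSpace_coe
  obtain ⟨m, hm, n, hn, hmn⟩ :=
    M.topologicalClosure.exists_add_mem_mem_orthogonal (WithLp.toLp 2 ((x : H), T x))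
  have hnT : n ∈ hilbertGraph T := by
    rw [← add_sub_cancel_left m n, ← hmn]
    exact Submodule.sub_mem _ (T.mem_graph x) (hMcl hm)
  have hn₀ : n = 0 := by
    obtain ⟨v, hv, hTv⟩ := (mem_graph_iff T).1 hnT
    have hv₀ : v = 0 := by
      refine eq_zero_of_forall_inner_add_inner_eq_zero hT hc fun u => ?_
      have hu : WithLp.toLp 2 ((u : H), T ⟨u, adjoint_product_le_domain u.2⟩) ∈ M :=
        (mem_graph_iff _).2 ⟨⟨u, u.2, adjoint_product_le_domain u.2⟩, rfl, rfl⟩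
      rw [hv, hTv]
      exact (Submodule.mem_orthogonal' _ _).1 hn _ (M.le_topologicalClosure hu)
    rw [hv₀] at hv hTv
    exact WithLp.ofLp_injective 2 (Prod.ext hv.symm (hTv.symm.trans T.map_zero))
  rw [hn₀, add_zero] at hmn
  rw [← hmn] at hm
  exact map_mem_closure (s := (M : Set (WithLp 2 (H × K)))) (WithLp.prod_continuous_ofLp 2 H K) hm
    fun _ hp => hp

theorem hasCore_adjoint_product (hT : Dense (T.domain : Set H)) (hc : T.IsClosed) :
    T.HasCore (product T† T).domain where
  le_domain := adjoint_product_le_domain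
  closure_eq := by
    refine eq_of_eq_graph ?_
    rw [← (hc.isClosable.leIsClosable domRestrict_le).graph_closure_eq_closure_graph]
    refine le_antisymm (Submodule.topologicalClosure_minimal _ (le_graph_of_le domRestrict_le) hc)
      ?_
    rintro ⟨_, _⟩ hp
    obtain ⟨x, rfl, rfl⟩ := (mem_graph_iff T).1 hp
    exact mem_closure_graph_domRestrict_adjoint_product hT hc x

variable [CompleteSpace L]

theorem sameForm_of_adjoint_product_eq (hT : Dense (T.domain : Set H)) (hTc : T.IsClosed)
    (hR : Dense (R.domain : Set H)) (hRc : R.IsClosed) (hTR : product T† T = product R† R) :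
    SameForm T R := by
  refine .of_hasCore hTc hRc (hasCore_adjoint_product hT hTc)
    (hTR ▸ hasCore_adjoint_product hR hRc) ?_
  rintro ⟨x, hxT⟩ ⟨_, hxR⟩ hx rfl
  obtain ⟨z, hz⟩ := mem_domain_iff.1 hx
  obtain ⟨_, hzT⟩ := (mem_graph_adjoint_product_iff hT).1 hz
  obtain ⟨_, hzR⟩ := (mem_graph_adjoint_product_iff hR).1 (hTR ▸ hz)
  have hinner := (hzT ⟨x, hxT⟩).trans (hzR ⟨x, hxR⟩).symm
  rw [inner_self_eq_norm_sq_to_K, inner_self_eq_norm_sq_to_K] at hinner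
  exact (sq_eq_sq₀ (norm_nonneg _) (norm_nonneg _)).1 (by exact_mod_cast hinner)

end AdjointProduct

theorem exists_smul_eq_and_smul_eq {R M : Type*} [Semiring R] [AddCommMonoid M] [Module R M]
    {c s : R} (hcs : Commute c s) (h : c * c + s * s = 1) {y z : M} (hyz : s • y = c • z) :
    ∃ w : M, c • w = y ∧ s • w = z := by
  refine ⟨c • y + s • z, ?_, ?_⟩
  · rw [smul_add, ← mul_smul, ← mul_smul, hcs.eq, mul_smul s c, ← hyz, ← mul_smul, ← add_smul, h,
      one_smul]
  · rw [smul_add, ← mul_smul, ← mul_smul, ← hcs.eq, mul_smul c s, hyz, ← mul_smul, ← add_smul, h,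
      one_smul]

theorem product_compInv_self {E : Type*} [AddCommGroup E] [Module ℂ E] {C S : Module.End ℂ E}
    {hinj : Function.Injective C} (hCS : Commute C S) (h : C * C + S * S = 1)
    {hinj' : Function.Injective (C * C)} :
    product (compInv S C hinj) (compInv S C hinj) = compInv (S * S) (C * C) hinj' := by
  refine eq_of_eq_graph (Submodule.ext ?_)
  rintro ⟨x, z⟩
  simp only [mem_graph_product, mem_graph_compInv]
  constructor
  · rintro ⟨_, ⟨v, rfl, rfl⟩, w, hw, rfl⟩
    obtain ⟨u, rfl, rfl⟩ := exists_smul_eq_and_smul_eq hCS h hw.symm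
    exact ⟨u, rfl, rfl⟩
  · rintro ⟨u, rfl, rfl⟩
    exact ⟨S (C u), ⟨C u, rfl, rfl⟩, S u, congrArg (fun T : Module.End ℂ E => T u) hCS.eq, rfl⟩

section SquareRoot

variable {H : Type*} [NormedAddCommGroup H] [InnerProductSpace ℂ H] [CompleteSpace H]
  {A B : H →ₗ.[ℂ] H}

/-- The resolvent `(1 + A)⁻¹` of a positive selfadjoint operator. -/
noncomputable def IsPositiveSelfAdjoint.resolvent (hA : IsPositiveSelfAdjoint A) : H →L[ℂ] H :=
  let e := LinearEquiv.ofBijective (oneAdd A) ⟨oneAdd_injective hA.nonneg, hA.surjective_oneAdd⟩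
  (A.domain.subtype ∘ₗ e.symm.toLinearMap).mkContinuous 1 fun h => by
    have hle := norm_le_norm_oneAdd hA.nonneg (e.symm h)
    rw [one_mul]
    exact hle.trans_eq (congrArg norm (e.apply_symm_apply h))

theorem IsPositiveSelfAdjoint.resolvent_oneAdd (hA : IsPositiveSelfAdjoint A) (x : A.domain) :
    hA.resolvent (oneAdd A x) = x :=
  congrArg Subtype.val (LinearEquiv.symm_apply_apply (LinearEquiv.ofBijective (oneAdd A) _) x)

theorem IsPositiveSelfAdjoint.one_sub_resolvent_oneAdd (hA : IsPositiveSelfAdjoint A)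
    (x : A.domain) : (1 - hA.resolvent) (oneAdd A x) = A x := by
  change oneAdd A x - hA.resolvent (oneAdd A x) = A x
  rw [hA.resolvent_oneAdd, oneAdd_apply, add_sub_cancel_left]

theorem IsPositiveSelfAdjoint.resolvent_nonneg (hA : IsPositiveSelfAdjoint A) :
    0 ≤ hA.resolvent := by
  rw [ContinuousLinearMap.nonneg_iff_isPositive, ContinuousLinearMap.isPositive_def]
  refine ⟨hA.surjective_oneAdd.forall₂.2 fun x y => ?_, hA.surjective_oneAdd.forall.2 fun x => ?_⟩
  · change ⟪hA.resolvent _, _⟫_ℂ = ⟪_, hA.resolvent _⟫_ℂ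
    rw [hA.resolvent_oneAdd, hA.resolvent_oneAdd, hA.isPositiveSymmetric.inner_oneAdd_left]
  · rw [ContinuousLinearMap.reApplyInnerSelf_apply, hA.resolvent_oneAdd,
      ← hA.isPositiveSymmetric.inner_oneAdd_left, oneAdd_apply, inner_add_left, map_add]
    exact add_nonneg inner_self_nonneg (hA.nonneg x)

theorem IsPositiveSelfAdjoint.one_sub_resolvent_nonneg (hA : IsPositiveSelfAdjoint A) :
    0 ≤ 1 - hA.resolvent := by
  have hsa : IsSelfAdjoint (1 - hA.resolvent) :=
    (IsSelfAdjoint.one _).sub (IsSelfAdjoint.of_nonneg hA.resolvent_nonneg)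
  rw [ContinuousLinearMap.nonneg_iff_isPositive, ContinuousLinearMap.isPositive_def]
  refine ⟨hsa.isSymmetric, hA.surjective_oneAdd.forall.2 fun x => ?_⟩
  rw [ContinuousLinearMap.reApplyInnerSelf_apply, hA.one_sub_resolvent_oneAdd, oneAdd_apply,
    inner_add_right, map_add]
  exact add_nonneg (hA.nonneg x) inner_self_nonneg

theorem IsPositiveSelfAdjoint.resolvent_injective (hA : IsPositiveSelfAdjoint A) :
    Function.Injective hA.resolvent := by
  refine (injective_iff_map_eq_zero _).2 (hA.surjective_oneAdd.forall.2 fun x hx => ?_)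
  rw [hA.resolvent_oneAdd] at hx
  rw [Subtype.ext hx (a2 := (0 : A.domain)), map_zero]

theorem IsPositiveSelfAdjoint.eq_compInv_resolvent (hA : IsPositiveSelfAdjoint A) :
    A = compInv (1 - hA.resolvent).toLinearMap hA.resolvent.toLinearMap
      hA.resolvent_injective := by
  refine eq_of_eq_graph (Submodule.ext ?_)
  rintro ⟨x, z⟩
  rw [mem_graph_compInv, hA.surjective_oneAdd.exists, mem_graph_iff]
  exact exists_congr fun u => by
    rw [ContinuousLinearMap.coe_coe, ContinuousLinearMap.coe_coe, hA.resolvent_oneAdd,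
      hA.one_sub_resolvent_oneAdd]

variable {C S : H →L[ℂ] H} {hinj : Function.Injective C.toLinearMap}

theorem isSelfAdjoint_compInv (hC : IsSelfAdjoint C) (hS : IsSelfAdjoint S) (hCS : Commute C S)
    (h : C * C + S * S = 1) : IsSelfAdjoint (compInv S.toLinearMap C.toLinearMap hinj) := by
  refine isSelfAdjoint_def.2 (eq_of_eq_graph (Submodule.ext ?_))
  rintro ⟨y, z⟩
  rw [mem_graph_adjoint_compInv (denseRange_of_isSelfAdjoint_of_injective hC hinj),
    mem_graph_compInv]
  constructor
  · intro hyz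
    have hyz' : S y = C z := ext_inner_left ℂ fun v =>
      (hS.isSymmetric v y).symm.trans ((hyz v).trans (hC.isSymmetric v z))
    exact exists_smul_eq_and_smul_eq hCS h hyz'
  · rintro ⟨w, rfl, rfl⟩ v
    refine (hS.isSymmetric v (C w)).trans (Eq.trans ?_ (hC.isSymmetric v (S w)).symm)
    exact congrArg (fun T : H →L[ℂ] H => ⟪v, T w⟫_ℂ) hCS.eq.symm

theorem isPositiveSelfAdjoint_compInv (hC : 0 ≤ C) (hS : 0 ≤ S) (hCS : Commute C S)
    (h : C * C + S * S = 1) :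
    IsPositiveSelfAdjoint (compInv S.toLinearMap C.toLinearMap hinj) where
  selfAdjoint := isSelfAdjoint_compInv (.of_nonneg hC) (.of_nonneg hS) hCS h
  nonneg := by
    refine forall_compInv_domain.2 fun v => ?_
    rw [compInv_apply]
    have hpos : 0 ≤ (⟪C (S v), v⟫_ℂ).re :=
      ((ContinuousLinearMap.nonneg_iff_isPositive _).1
        (hCS.mul_nonneg hC hS)).re_inner_nonneg_left v
    rwa [show ⟪C (S v), v⟫_ℂ = ⟪S v, C v⟫_ℂ from
      (IsSelfAdjoint.of_nonneg hC).isSymmetric (S v) v] at hpos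

-- With `C² = B` and `S² = 1 - B`, the square root of `(1 - B) B⁻¹` is `S C⁻¹`.
theorem exists_isSqrt_compInv {B : H →L[ℂ] H} (hB : 0 ≤ B) (hB' : 0 ≤ 1 - B)
    (hinj : Function.Injective B.toLinearMap) :
    ∃ R, IsSqrt R (compInv (1 - B).toLinearMap B.toLinearMap hinj) := by
  have hcomm : Commute (CFC.sqrt B) (CFC.sqrt (1 - B)) := by
    have h : Commute B (1 - B) := (Commute.one_right B).sub_right (Commute.refl B)
    exact ((h.cfcₙ_nnreal NNReal.sqrt).symm.cfcₙ_nnreal NNReal.sqrt).symm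
  have hC : CFC.sqrt B * CFC.sqrt B = B := CFC.sqrt_mul_sqrt_self B hB
  have hS : CFC.sqrt (1 - B) * CFC.sqrt (1 - B) = 1 - B := CFC.sqrt_mul_sqrt_self (1 - B) hB'
  have hsum : CFC.sqrt B * CFC.sqrt B + CFC.sqrt (1 - B) * CFC.sqrt (1 - B) = 1 := by
    rw [hC, hS, add_sub_cancel]
  have hCC : Function.Injective (CFC.sqrt B * CFC.sqrt B).toLinearMap := by rwa [hC]
  have hCinj : Function.Injective (CFC.sqrt B).toLinearMap := .of_comp hCC
  refine ⟨compInv _ _ hCinj, isPositiveSelfAdjoint_compInv (CFC.sqrt_nonneg B)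
    (CFC.sqrt_nonneg (1 - B)) hcomm hsum, ?_⟩
  calc product (compInv _ _ hCinj) (compInv _ _ hCinj)
      = compInv (CFC.sqrt (1 - B) * CFC.sqrt (1 - B)).toLinearMap
          (CFC.sqrt B * CFC.sqrt B).toLinearMap hCC :=
        product_compInv_self (hcomm.map ContinuousLinearMap.toLinearMapRingHom)
          (congrArg ContinuousLinearMap.toLinearMap hsum)
    _ = compInv (1 - B).toLinearMap B.toLinearMap hinj := by simp only [hC, hS]

theorem IsPositiveSelfAdjoint.isSqrt_sqrt (hA : IsPositiveSelfAdjoint A) : IsSqrt (sqrt A) A := by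
  have h : ∃ R, IsSqrt R A := by
    rw [hA.eq_compInv_resolvent]
    exact exists_isSqrt_compInv hA.resolvent_nonneg hA.one_sub_resolvent_nonneg _
  rw [sqrt, dif_pos h]
  exact h.choose_spec

theorem IsSqrt.adjoint_product_eq {R : H →ₗ.[ℂ] H} (h : IsSqrt R A) : product R† R = A := by
  rw [isSelfAdjoint_def.1 h.1.selfAdjoint, h.2]

theorem sameForm_sqrt_adjoint_product {K : Type*} [NormedAddCommGroup K] [InnerProductSpace ℂ K]
    [CompleteSpace K] {T : H →ₗ.[ℂ] K} (hT : Dense (T.domain : Set H)) (hc : T.IsClosed) :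
    SameForm (sqrt (product T† T)) T := by
  have h := (isPositiveSelfAdjoint_adjoint_product hT hc).isSqrt_sqrt
  exact sameForm_of_adjoint_product_eq h.1.selfAdjoint.dense_domain h.1.selfAdjoint.isClosed
    hT hc h.adjoint_product_eq

theorem FormLE.antisymm (hA : IsPositiveSelfAdjoint A) (hB : IsPositiveSelfAdjoint B)
    (hAB : FormLE A B) (hBA : FormLE B A) : A = B := by
  have h : SameForm (sqrt A) (sqrt B) := by
    refine ⟨le_antisymm (fun x hx => (hBA x hx).1) (fun x hx => (hAB x hx).1), ?_⟩
    rintro ⟨x, hx⟩ ⟨_, hx'⟩ rfl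
    exact le_antisymm (hAB x hx').2 (hBA x hx).2
  rw [← hA.isSqrt_sqrt.adjoint_product_eq, ← hB.isSqrt_sqrt.adjoint_product_eq]
  exact h.adjoint_product_eq hA.isSqrt_sqrt.1.selfAdjoint.dense_domain

end SquareRoot

section SumOfForms

variable {H : Type*} [NormedAddCommGroup H] [InnerProductSpace ℂ H] [CompleteSpace H]

theorem formSum_eq_adjoint_product_pair_sqrt {A B : H →ₗ.[ℂ] H}
    (hD : Dense ((pair (sqrt A) (sqrt B)).domain : Set H)) :
    formSum A B = product (pair (sqrt A) (sqrt B))† (pair (sqrt A) (sqrt B)) := by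
  refine eq_of_eq_graph ?_
  rw [formSum, Submodule.toLinearPMap_graph_eq _ (formSumGraph_singleValued A B hD)]
  ext ⟨x, z⟩
  rw [mem_graph_adjoint_product_iff hD]
  exact ⟨fun ⟨hA, hB, h⟩ => ⟨⟨hA, hB⟩, fun y => h y y.2.1 y.2.2⟩,
    fun ⟨hx, h⟩ => ⟨hx.1, hx.2, fun y kA kB => h ⟨y, kA, kB⟩⟩⟩

theorem formSum_adjoint_product {K L : Type*} [NormedAddCommGroup K] [InnerProductSpace ℂ K]
    [CompleteSpace K] [NormedAddCommGroup L] [InnerProductSpace ℂ L] [CompleteSpace L]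
    {T : H →ₗ.[ℂ] K} {R : H →ₗ.[ℂ] L} (hT : T.IsClosed) (hR : R.IsClosed)
    (hD : Dense ((pair T R).domain : Set H)) :
    formSum (product T† T) (product R† R) = product (pair T R)† (pair T R) := by
  have hform := (sameForm_sqrt_adjoint_product (hD.mono fun _ hx => hx.1) hT).pair
    (sameForm_sqrt_adjoint_product (hD.mono fun _ hx => hx.2) hR)
  have hD' := hform.domain_eq ▸ hD
  rw [formSum_eq_adjoint_product_pair_sqrt hD', hform.adjoint_product_eq hD']

end SumOfForms

section EnergySpace

variable {H : Type*} [NormedAddCommGroup H] [InnerProductSpace ℂ H] {a b : H →ₗ.[ℂ] H}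
  (ha : IsPositiveSymmetric a) (hd : Dense (formDomain a))

theorem RanSpace.mk_surjective : Function.Surjective (RanSpace.mk ha hd) := fun u =>
  ⟨RanSpace.preimage ha hd u, Subtype.ext (RanSpace.apply_preimage ha hd u)⟩

theorem RanSpace.norm_mk_sq (x : a.domain) :
    ‖RanSpace.mk ha hd x‖ ^ 2 = (⟪a x, (x : H)⟫_ℂ).re := by
  rw [← RanSpace.inner_eq ha hd x x]
  exact (inner_self_eq_norm_sq (𝕜 := ℂ) _).symm

/-- The operator `J_a : ax ↦ ax` from the energy space `H_a` to `H`, with domain `ran a`. -/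
noncomputable def energyInclusion : EnergySpace ha hd →ₗ.[ℂ] H :=
  compInv (RanSpace.incl ha hd)
    (UniformSpace.Completion.toComplₗᵢ (𝕜 := ℂ) (E := RanSpace ha hd)).toLinearMap
    (UniformSpace.Completion.toComplₗᵢ (𝕜 := ℂ) (E := RanSpace ha hd)).injective

theorem dense_energyInclusion_domain :
    Dense ((energyInclusion ha hd).domain : Set (EnergySpace ha hd)) :=
  UniformSpace.Completion.denseRange_coe

theorem forall_energyInclusion_domain {p : EnergySpace ha hd → H → Prop} :
    (∀ u : (energyInclusion ha hd).domain, p u (energyInclusion ha hd u)) ↔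
      ∀ x : a.domain, p (RanSpace.mk ha hd x : EnergySpace ha hd) (a x) := by
  unfold energyInclusion
  rw [forall_compInv_domain, (RanSpace.mk_surjective ha hd).forall]
  simp only [compInv_apply]
  rfl

theorem mem_graph_adjoint_energyInclusion {y : H} {w : EnergySpace ha hd} :
    (y, w) ∈ (energyInclusion ha hd)†.graph ↔
      ∀ x : a.domain, ⟪a x, y⟫_ℂ = ⟪(RanSpace.mk ha hd x : EnergySpace ha hd), w⟫_ℂ := by
  rw [mem_graph_adjoint_iff (dense_energyInclusion_domain ha hd)]
  exact forall_energyInclusion_domain ha hd (p := fun u v => ⟪v, y⟫_ℂ = ⟪u, w⟫_ℂ)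

theorem exists_norm_adjoint_energyInclusion_apply_le {y : H} {c : ℝ} (hc : 0 ≤ c)
    (h : ∀ x : a.domain, ‖⟪a x, y⟫_ℂ‖ ≤ c * ‖RanSpace.mk ha hd x‖) :
    ∃ hy : y ∈ (energyInclusion ha hd)†.domain, ‖(energyInclusion ha hd)† ⟨y, hy⟩‖ ≤ c := by
  refine exists_norm_adjoint_apply_le (dense_energyInclusion_domain ha hd) hc ?_
  refine (forall_energyInclusion_domain ha hd (p := fun u v => ‖⟪v, y⟫_ℂ‖ ≤ c * ‖u‖)).2 fun x => ?_
  rw [UniformSpace.Completion.norm_coe]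
  exact h x

theorem formDomain_subset_adjoint_energyInclusion_domain :
    formDomain a ⊆ (energyInclusion ha hd)†.domain := by
  rintro y ⟨m, hm⟩
  refine (exists_norm_adjoint_energyInclusion_apply_le ha hd (Real.sqrt_nonneg m) fun x => ?_).1
  rw [← Real.sqrt_sq (norm_nonneg (RanSpace.mk ha hd x)), ← Real.sqrt_mul' m (sq_nonneg _),
    RanSpace.norm_mk_sq]
  exact Real.le_sqrt_of_sq_le (hm x)

theorem dense_adjoint_energyInclusion_domain :
    Dense ((energyInclusion ha hd)†.domain : Set H) :=
  hd.mono (formDomain_subset_adjoint_energyInclusion_domain ha hd)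

theorem isClosed_adjoint_energyInclusion : (energyInclusion ha hd)†.IsClosed :=
  adjoint_isClosed (dense_energyInclusion_domain ha hd)

section Sum

variable (hb : IsPositiveSymmetric b) (hab : Dense (formDomain a ∩ formDomain b))

theorem inner_ranSumEmbedding_left (hdb : Dense (formDomain b)) (u : RanSpace ha hd)
    (v : RanSpace hb hdb) (w : WithLp 2 (EnergySpace ha hd × EnergySpace hb hdb)) :
    ⟪ranSumEmbedding ha hd hb hdb (u, v), w⟫_ℂ =
      ⟪UniformSpace.Completion.toComplₗᵢ (𝕜 := ℂ) u, w.fst⟫_ℂ +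
        ⟪UniformSpace.Completion.toComplₗᵢ (𝕜 := ℂ) v, w.snd⟫_ℂ := rfl

theorem denseRange_ranSumEmbedding (hdb : Dense (formDomain b)) :
    DenseRange (ranSumEmbedding ha hd hb hdb) := by
  have h : DenseRange (Prod.map ((↑) : RanSpace ha hd → EnergySpace ha hd)
      ((↑) : RanSpace hb hdb → EnergySpace hb hdb)) :=
    UniformSpace.Completion.denseRange_coe.prodMap UniformSpace.Completion.denseRange_coe
  exact (WithLp.homeomorphProd 2 _ _).symm.surjective.denseRange.comp h
    (WithLp.homeomorphProd 2 _ _).symm.continuous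

theorem adjoint_sumOperator :
    (sumOperator ha hb hab)† = pair (energyInclusion ha (hab.mono Set.inter_subset_left))†
      (energyInclusion hb (hab.mono Set.inter_subset_right))† := by
  refine eq_of_eq_graph (Submodule.ext ?_)
  rintro ⟨y, w⟩
  rw [mem_graph_pair, energyInclusion, energyInclusion,
    mem_graph_adjoint_compInv UniformSpace.Completion.denseRange_coe,
    mem_graph_adjoint_compInv UniformSpace.Completion.denseRange_coe]
  refine (mem_graph_adjoint_compInv (denseRange_ranSumEmbedding ha _ hb _)).trans ?_
  simp only [Prod.forall, LinearMap.coprod_apply, inner_add_left, inner_ranSumEmbedding_left,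
    LinearIsometry.coe_toLinearMap]
  refine ⟨fun h => ⟨fun u => ?_, fun v => ?_⟩, fun h u v => congrArg₂ (· + ·) (h.1 u) (h.2 v)⟩
  · simpa only [map_zero, inner_zero_left, add_zero] using h u 0
  · simpa only [map_zero, inner_zero_left, zero_add] using h 0 v

end Sum

variable [CompleteSpace H]

/-- The operator `J_a** J_a*`, which turns out to be the Krein–von Neumann extension of `a`. -/
noncomputable def kreinExtension : H →ₗ.[ℂ] H :=
  product (energyInclusion ha hd)†† (energyInclusion ha hd)†

theorem isPositiveSelfAdjoint_kreinExtension : IsPositiveSelfAdjoint (kreinExtension ha hd) :=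
  isPositiveSelfAdjoint_adjoint_product (dense_adjoint_energyInclusion_domain ha hd)
    (isClosed_adjoint_energyInclusion ha hd)

theorem le_kreinExtension : a ≤ kreinExtension ha hd := by
  refine le_of_le_graph ?_
  rintro ⟨_, _⟩ hx
  obtain ⟨x, rfl, rfl⟩ := (mem_graph_iff a).1 hx
  refine mem_graph_product.2 ⟨(RanSpace.mk ha hd x : EnergySpace ha hd), ?_, ?_⟩
  · refine (mem_graph_adjoint_energyInclusion ha hd).2 fun u => ?_
    rw [UniformSpace.Completion.inner_coe, RanSpace.inner_eq]
  · have hle : energyInclusion ha hd ≤ (energyInclusion ha hd)†† :=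
      IsFormalAdjoint.le_adjoint (dense_adjoint_energyInclusion_domain ha hd)
        (adjoint_isFormalAdjoint (dense_energyInclusion_domain ha hd))
    exact le_graph_of_le hle (mem_graph_compInv.2 ⟨RanSpace.mk ha hd x, rfl, rfl⟩)

theorem norm_inner_apply_le_of_le_adjoint_product {K : Type*} [NormedAddCommGroup K]
    [InnerProductSpace ℂ K] {T : H →ₗ.[ℂ] K} (hT : Dense (T.domain : Set H))
    (haT : a ≤ product T† T) (x : T.domain) (z : a.domain) :
    ‖⟪a z, (x : H)⟫_ℂ‖ ≤ ‖T x‖ * ‖RanSpace.mk ha hd z‖ := by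
  obtain ⟨hz, h⟩ :=
    (mem_graph_adjoint_product_iff hT).1 (le_graph_of_le haT (a.mem_graph z))
  have hnorm : ‖RanSpace.mk ha hd z‖ = ‖T ⟨z, hz⟩‖ := by
    rw [← sq_eq_sq₀ (norm_nonneg _) (norm_nonneg _), RanSpace.norm_mk_sq, ha.symm, ← h ⟨z, hz⟩]
    exact inner_self_eq_norm_sq (𝕜 := ℂ) _
  rw [norm_inner_symm, ← h x, hnorm]
  exact norm_inner_le_norm _ _

theorem formLE_kreinExtension {S : H →ₗ.[ℂ] H} (hS : IsPositiveSelfAdjoint S) (haS : a ≤ S) :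
    FormLE (kreinExtension ha hd) S := by
  intro x hx
  have hform : SameForm (sqrt (kreinExtension ha hd)) (energyInclusion ha hd)† :=
    sameForm_sqrt_adjoint_product (dense_adjoint_energyInclusion_domain ha hd)
      (isClosed_adjoint_energyInclusion ha hd)
  have haS' : a ≤ product (sqrt S)† (sqrt S) := by rwa [hS.isSqrt_sqrt.adjoint_product_eq]
  obtain ⟨hx', hle⟩ := exists_norm_adjoint_energyInclusion_apply_le ha hd (norm_nonneg _)
    (norm_inner_apply_le_of_le_adjoint_product ha hd hS.isSqrt_sqrt.1.selfAdjoint.dense_domain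
      haS' ⟨x, hx⟩)
  exact ⟨hform.domain_eq ▸ hx', (hform.norm_eq rfl).trans_le hle⟩

theorem isKreinVonNeumannExtension_kreinExtension :
    IsKreinVonNeumannExtension a (kreinExtension ha hd) :=
  ⟨isPositiveSelfAdjoint_kreinExtension ha hd, le_kreinExtension ha hd,
    fun _ => formLE_kreinExtension ha hd⟩

theorem IsKreinVonNeumannExtension.unique {S T : H →ₗ.[ℂ] H}
    (hS : IsKreinVonNeumannExtension a S) (hT : IsKreinVonNeumannExtension a T) : S = T :=
  FormLE.antisymm hS.positiveSelfAdjoint hT.positiveSelfAdjoint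
    (hS.least T hT.positiveSelfAdjoint hT.extends_op)
    (hT.least S hS.positiveSelfAdjoint hS.extends_op)

theorem formSum_kreinExtension (hb : IsPositiveSymmetric b)
    (hab : Dense (formDomain a ∩ formDomain b)) :
    formSum (kreinExtension ha (hab.mono Set.inter_subset_left))
        (kreinExtension hb (hab.mono Set.inter_subset_right)) =
      product (sumOperator ha hb hab)†† (sumOperator ha hb hab)† := by
  rw [adjoint_sumOperator]
  refine formSum_adjoint_product (isClosed_adjoint_energyInclusion ha _)
    (isClosed_adjoint_energyInclusion hb _) (hab.mono fun x hx => ⟨?_, ?_⟩)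
  · exact formDomain_subset_adjoint_energyInclusion_domain ha _ hx.1
  · exact formDomain_subset_adjoint_energyInclusion_domain hb _ hx.2

end EnergySpace

end FormSum

theorem theorem2 {H : Type*} [NormedAddCommGroup H] [InnerProductSpace ℂ H] [CompleteSpace H]
    (a b : H →ₗ.[ℂ] H) (ha : FormSum.IsPositiveSymmetric a) (hb : FormSum.IsPositiveSymmetric b)
    (hab : Dense (FormSum.formDomain a ∩ FormSum.formDomain b)) :
    (∃! aK, FormSum.IsKreinVonNeumannExtension a aK) ∧
    (∃! bK, FormSum.IsKreinVonNeumannExtension b bK) ∧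
    ∀ aK bK : H →ₗ.[ℂ] H,
      FormSum.IsKreinVonNeumannExtension a aK → FormSum.IsKreinVonNeumannExtension b bK →
      FormSum.formSum aK bK =
        FormSum.product (FormSum.sumOperator ha hb hab).adjoint.adjoint
          (FormSum.sumOperator ha hb hab).adjoint := by
  have hA := FormSum.isKreinVonNeumannExtension_kreinExtension ha
    (hab.mono Set.inter_subset_left)
  have hB := FormSum.isKreinVonNeumannExtension_kreinExtension hb
    (hab.mono Set.inter_subset_right)
  refine ⟨⟨_, hA, fun S hS => hS.unique hA⟩, ⟨_, hB, fun S hS => hS.unique hB⟩,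
    fun aK bK haK hbK => ?_⟩
  rw [haK.unique hA, hbK.unique hB]
  exact FormSum.formSum_kreinExtension ha hb hab
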